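/- All graphs are finite, simple and have at least one vertex; $\omega(G)$ and $\chi(G)$ denote the clique number and the chromatic number of $G$, and $\mathbb{N}$ is the set of positive integers. For disjoint sets of vertices, $X$ is complete (anticomplete) to $Y$ if every vertex of $X$ is adjacent (nonadjacent) to every vertex of $Y$; $N_G[v]$ is the closed neighborhood of $v$. Let $k\ge 4$ be an integer, and read indices modulo $k$. * A $k$-hyperhole is a graph $H$ whose vertex set can be partitioned into nonempty cliques $X_1,\dots,X_k$ such that each $X_i$ is complete to $X_{i-1}\cup X_{i+1}$ and anticomplete to $V(H)\setminus(X_{i-1}\cup X_i\cup X_{i+1})$. * A $k$-hyperantihole is a graph $A$ whose vertex set can be partitioned into nonempty cliques $X_1,\dots,X_k$ such that each $X_i$ is complete to $V(A)\setminus(X_{i-1}\cup X_i\cup X_{i+1})$ and anticomplete to $X_{i-1}\cup X_{i+1}$. * A $k$-ring is a graph $R$ whose vertex set can be partitioned into nonempty sets $X_1,\dots,X_k$ such that each $X_i$ can be ordered as $X_i=\{u_i^1,\dots,u_i^{|X_i|}\}$ with $X_i\subseteq N_R[u_i^{|X_i|}]\subseteq\dots\subseteq N_R[u_i^1]=X_{i-1}\cup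 X_i\cup X_{i+1}$. Let $\mathcal{H}_k$ (respectively $\mathcal{A}_k$) be the class of all induced subgraphs, up to isomorphism, of $k$-hyperholes (respectively $k$-hyperantiholes), and let $\mathcal{R}_k$ be the class of all graphs $G$ such that every induced subgraph of $G$ either is a $k$-ring or has a simplicial vertex, i.e. a vertex whose (possibly empty) neighborhood is a clique. Put $\mathcal{H}_{\ge 4}=\bigcup_{k\ge 4}\mathcal{H}_k$, $\mathcal{A}_{\ge 4}=\bigcup_{k\ge 4}\mathcal{A}_k$ and $\mathcal{R}_{\ge 4}=\bigcup_{k\ge 4}\mathcal{R}_k$. A class is hereditary if it contains all isomorphic copies of induced subgraphs of its members. A hereditary class $\mathcal{G}$ is $\chi$-bounded if there is a function $f:\mathbb{N}\to\mathbb{N}$ (a $\chi$-bounding function for $\mathcal{G}$) such that $\chi(G)\le f(\omega(G))$ for all $G\in\mathcal{G}$. If moreover $\mathcal{G}$ contains all complete graphs, a $\chi$-bounding function $f$ for $\mathcal{G}$ is optimal if for every $n\in\mathbb{N}$ there is a graph $G\in\mathcal{G}$ with $\omega(G)=n$ and $\chi(G)=f(n)$. Let $f_{\mathrm{T}}:\mathbb{N}\to\mathbb{N}$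 be given by $f_{\mathrm{T}}(n)=\lfloor 5n/4\rfloor$ if $n\equiv 0,1\pmod 4$ and $f_{\mathrm{T}}(n)=\lceil 5n/4\rceil$ if $n\equiv 2,3\pmod 4$. **Theorem.** The classes $\mathcal{H}_{\ge 4}$, $\mathcal{A}_{\ge 4}$ and $\mathcal{R}_{\ge 4}$ are hereditary, contain all complete graphs, and are $\chi$-bounded. Furthermore, $f_{\mathrm{T}}$ is the optimal $\chi$-bounding function for each of the three classes. -/

import Mathlib

universe u

namespace RingColoring

open SimpleGraph

/-- A class of graphs. All classes below contain only finite graphs with at least one vertex. -/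
abbrev GraphClass := (V : Type u) → SimpleGraph V → Prop

section Basic

variable {V : Type u}

/-- `S` is complete to `T`: every vertex of `S` is adjacent to every vertex of `T`. -/
def CompleteTo (G : SimpleGraph V) (S T : Set V) : Prop :=
  ∀ s ∈ S, ∀ t ∈ T, G.Adj s t

/-- `S` is anticomplete to `T`: no vertex of `S` is adjacent to a vertex of `T`. -/
def AnticompleteTo (G : SimpleGraph V) (S T : Set V) : Prop :=
  ∀ s ∈ S, ∀ t ∈ T, ¬ G.Adj s t

/-- The closed neighborhood `N[v]`. -/
def closedNbhd (G : SimpleGraph V) (v : V) : Set V :=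
  insert v (G.neighborSet v)

/-- A partition of the vertex set into `k` nonempty sets, indexed cyclically. -/
structure IsCyclicPartition {k : ℕ} (X : ZMod k → Set V) : Prop where
  nonempty : ∀ i, (X i).Nonempty
  disjoint : ∀ i j, i ≠ j → Disjoint (X i) (X j)
  cover : ⋃ i, X i = Set.univ

/-- `G` is a `k`-hyperhole (only possible for `k ≥ 4`). -/
def IsHyperhole (k : ℕ) (G : SimpleGraph V) : Prop :=
  4 ≤ k ∧ ∃ X : ZMod k → Set V, IsCyclicPartition X ∧
    (∀ i, G.IsClique (X i)) ∧
    (∀ i, CompleteTo G (X i) (X (i - 1) ∪ X (i + 1))) ∧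
    (∀ i, AnticompleteTo G (X i) (X (i - 1) ∪ X i ∪ X (i + 1))ᶜ)

/-- `G` is a `k`-hyperantihole (only possible for `k ≥ 4`). -/
def IsHyperantihole (k : ℕ) (G : SimpleGraph V) : Prop :=
  4 ≤ k ∧ ∃ X : ZMod k → Set V, IsCyclicPartition X ∧
    (∀ i, G.IsClique (X i)) ∧
    (∀ i, CompleteTo G (X i) (X (i - 1) ∪ X i ∪ X (i + 1))ᶜ) ∧
    (∀ i, AnticompleteTo G (X i) (X (i - 1) ∪ X (i + 1)))

/-- `G` is a `k`-ring (only possible for `k ≥ 4`): each part `X i` can be enumerated without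
repetition as `u 0, ..., u m` so that
`X i ⊆ N[u m] ⊆ ... ⊆ N[u 0] = X (i - 1) ∪ X i ∪ X (i + 1)`. -/
def IsRing (k : ℕ) (G : SimpleGraph V) : Prop :=
  4 ≤ k ∧ ∃ X : ZMod k → Set V, IsCyclicPartition X ∧
    ∀ i, ∃ (m : ℕ) (u : Fin (m + 1) → V),
      Function.Injective u ∧ Set.range u = X i ∧
      X i ⊆ closedNbhd G (u (Fin.last m)) ∧
      Antitone (fun j => closedNbhd G (u j)) ∧
      closedNbhd G (u 0) = X (i - 1) ∪ X i ∪ X (i + 1)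

/-- `v` is simplicial: its (possibly empty) neighborhood is a clique. -/
def IsSimplicial (G : SimpleGraph V) (v : V) : Prop :=
  G.IsClique (G.neighborSet v)

end Basic

/-- `H_k`: all (nonnull) induced subgraphs of (finite) `k`-hyperholes, up to isomorphism. -/
def hyperholeClass (k : ℕ) : GraphClass.{u} := fun V G =>
  Finite V ∧ Nonempty V ∧
    ∃ (W : Type u) (H : SimpleGraph W), Finite W ∧ IsHyperhole k H ∧ G ⊴ H

/-- `A_k`: all (nonnull) induced subgraphs of (finite) `k`-hyperantiholes, up to isomorphism. -/
def hyperantiholeClass (k : ℕ) : GraphClass.{u} := fun V G =>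
  Finite V ∧ Nonempty V ∧
    ∃ (W : Type u) (A : SimpleGraph W), Finite W ∧ IsHyperantihole k A ∧ G ⊴ A

/-- `R_k`: all graphs every (nonnull) induced subgraph of which is a `k`-ring or has a
simplicial vertex. -/
def ringClass (k : ℕ) : GraphClass.{u} := fun V G =>
  Finite V ∧ Nonempty V ∧
    ∀ S : Set V, S.Nonempty →
      IsRing k (G.induce S) ∨ ∃ v, IsSimplicial (G.induce S) v

/-- `H_{≥ k}`, the union of the `H_i` with `i ≥ k`. -/
def hyperholeClassGE (k : ℕ) : GraphClass.{u} := fun V G =>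
  ∃ i, k ≤ i ∧ hyperholeClass i V G

/-- `A_{≥ k}`, the union of the `A_i` with `i ≥ k`. -/
def hyperantiholeClassGE (k : ℕ) : GraphClass.{u} := fun V G =>
  ∃ i, k ≤ i ∧ hyperantiholeClass i V G

/-- `R_{≥ k}`, the union of the `R_i` with `i ≥ k`. -/
def ringClassGE (k : ℕ) : GraphClass.{u} := fun V G =>
  ∃ i, k ≤ i ∧ ringClass i V G

/-- A class is hereditary if it contains all isomorphic copies of (nonnull) induced subgraphs
of its members. -/
def IsHereditary (𝒢 : GraphClass.{u}) : Prop :=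
  ∀ (V W : Type u) (G : SimpleGraph V) (H : SimpleGraph W),
    𝒢 V G → Nonempty W → H ⊴ G → 𝒢 W H

/-- The class contains all (finite, nonnull) complete graphs. -/
def ContainsCompleteGraphs (𝒢 : GraphClass.{u}) : Prop :=
  ∀ V : Type u, Finite V → Nonempty V → 𝒢 V ⊤

/-- `f` is a `χ`-bounding function for `𝒢`. As graphs in the classes considered are finite and
nonnull, their clique numbers are positive, and the value `f 0` is irrelevant. -/
def IsChiBounding (𝒢 : GraphClass.{u}) (f : ℕ → ℕ) : Prop :=
  ∀ (V : Type u) (G : SimpleGraph V), 𝒢 V G → G.chromaticNumber ≤ (f G.cliqueNum : ℕ∞)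

/-- `𝒢` is a `χ`-bounded (in particular hereditary) class. -/
def IsChiBounded (𝒢 : GraphClass.{u}) : Prop :=
  IsHereditary 𝒢 ∧ ∃ f : ℕ → ℕ, IsChiBounding 𝒢 f

/-- `f` is the optimal `χ`-bounding function for the hereditary `χ`-bounded class `𝒢`, which
contains all complete graphs. -/
def IsOptimalChiBounding (𝒢 : GraphClass.{u}) (f : ℕ → ℕ) : Prop :=
  IsChiBounded 𝒢 ∧ ContainsCompleteGraphs 𝒢 ∧ IsChiBounding 𝒢 f ∧
    ∀ n : ℕ, 1 ≤ n → ∃ (V : Type u) (G : SimpleGraph V),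
      𝒢 V G ∧ G.cliqueNum = n ∧ G.chromaticNumber = (f n : ℕ∞)

/-- The function `f_T`. -/
def fT (n : ℕ) : ℕ :=
  if n % 4 = 0 ∨ n % 4 = 1 then ⌊(5 * n / 4 : ℚ)⌋₊ else ⌈(5 * n / 4 : ℚ)⌉₊

end RingColoring

/-! ### The function $f_T$ and the staircase colouring over the 5-cycle. -/

namespace RingColoring

universe v

open SimpleGraph

/-! In closed form $f_T(n) = n + \lceil \lfloor n/2\rfloor/2\rceil$; it is strictly increasing and
gains 5 every 4 steps.

Upper bound for rings. Number each part by decreasing neighbourhood. If the $j$-th vertex of $X_i$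
is adjacent to the $l$-th of $X_{i+1}$, the first $j$ of one and the first $l$ of the other form a
clique, so $j+l\le\omega$. Hence a ring maps to a universal "staircase" over the $k$-cycle, and
then, through a homomorphism from the $k$-cycle to the 5-cycle, to the staircase over the 5-cycle.
That single graph is coloured by induction from $n$ to $n+4$ with five new colours
(`exists_coloring_staircase`). Simplicial vertices are then added greedily
(`colorable_of_forall_induce`), and hyperholes inherit the bound because their class lies inside the
class of rings.

Upper bound for hyperantiholes. Stable sets of parts in the cycle give cliques, and two consecutive
parts are anticomplete, so a colouring can be read off from a cover of the part sizes by edges of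
the cycle. `exists_edge_cover` removes an edge meeting every stable set of maximum weight; when no
such edge exists, an exchange argument makes all weights equal, and alternating halves suffice.

Optimality. Blow up the 5-cycle into cliques of sizes $p,q,p,q,q$ with $p=\lceil n/2\rceil$,
$q=\lfloor n/2\rfloor$. Colour classes have at most two vertices, which forces $f_T(n)$ colours.
Since the 5-cycle is self-complementary, this one graph serves all three classes. -/

theorem fT_eq (n : ℕ) : fT n = n + (n / 2 + 1) / 2 := by
  obtain ⟨m, r, hr, rfl⟩ : ∃ m r, r < 4 ∧ n = 4 * m + r :=
    ⟨n / 4, n % 4, Nat.mod_lt _ (by norm_num), by omega⟩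
  unfold fT
  have hmod : (4 * m + r) % 4 = r := by omega
  rw [hmod]
  interval_cases r
  · rw [if_pos (by norm_num), Nat.floor_eq_iff (by positivity)]
    have h : 4 * m + 0 + ((4 * m + 0) / 2 + 1) / 2 = 5 * m := by omega
    rw [h]; push_cast; constructor <;> linarith
  · rw [if_pos (by norm_num), Nat.floor_eq_iff (by positivity)]
    have h : 4 * m + 1 + ((4 * m + 1) / 2 + 1) / 2 = 5 * m + 1 := by omega
    rw [h]; push_cast; constructor <;> linarith
  · rw [if_neg (by norm_num), Nat.ceil_eq_iff (by omega)]
    have h : 4 * m + 2 + ((4 * m + 2) / 2 + 1) / 2 = 5 * m + 3 := by omega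
    have h' : 5 * m + 3 - 1 = 5 * m + 2 := by omega
    rw [h, h']; push_cast; constructor <;> linarith
  · rw [if_neg (by norm_num), Nat.ceil_eq_iff (by omega)]
    have h : 4 * m + 3 + ((4 * m + 3) / 2 + 1) / 2 = 5 * m + 4 := by omega
    have h' : 5 * m + 4 - 1 = 5 * m + 3 := by omega
    rw [h, h']; push_cast; constructor <;> linarith

theorem fT_add_four (n : ℕ) : fT (n + 4) = fT n + 5 := by
  simp only [fT_eq]; omega

theorem fT_lt_fT_succ (n : ℕ) : fT n < fT (n + 1) := by
  simp only [fT_eq]; omega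

theorem fT_strictMono : StrictMono fT := strictMono_nat_of_lt_succ fT_lt_fT_succ

theorem le_fT (n : ℕ) : n ≤ fT n := by
  rw [fT_eq]; omega

/-- The `5`-ring with vertices `(i, j)`, `1 ≤ j ≤ n`, in which `(i, j)` and `(i + 1, l)` are
adjacent iff `j + l ≤ n`, can be coloured with `fT n` colours. -/
theorem exists_coloring_staircase (n : ℕ) : ∃ c : ZMod 5 → ℕ → ℕ,
    (∀ i j, 1 ≤ j → j ≤ n → c i j < fT n) ∧
    (∀ i j l, 1 ≤ j → j ≤ n → 1 ≤ l → l ≤ n → c i j = c i l → j = l) ∧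
    (∀ i j l, 1 ≤ j → 1 ≤ l → j + l ≤ n → c i j ≠ c (i + 1) l) := by
  induction n using Nat.strong_induction_on with
  | _ n ih =>
  rcases lt_or_ge n 4 with hn | hn
  · interval_cases n
    · exact ⟨fun _ _ => 0, by omega, by omega, by omega⟩
    · exact ⟨fun _ _ => 0, by simp [fT_eq], by omega, by omega⟩
    -- Only height 1 has neighbours in other parts, so it needs a 3-colouring of the 5-cycle; height
    -- 2 just avoids the colour of its own height 1.
    · refine ⟨fun i j => if j = 1 then ![0, 1, 0, 1, 2] i else ![1, 0, 1, 2, 0] i, ?_, ?_, ?_⟩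
      · intro i j h1 h2
        have : j = 1 ∨ j = 2 := by omega
        simp only [fT_eq]
        rcases this with rfl | rfl <;> revert i <;> decide
      · intro i j l h1 h2 h3 h4
        have hj : j = 1 ∨ j = 2 := by omega
        have hl : l = 1 ∨ l = 2 := by omega
        rcases hj with rfl | rfl <;> rcases hl with rfl | rfl <;>
          revert i <;> decide
      · intro i j l h1 h2 h3
        obtain rfl : j = 1 := by omega
        obtain rfl : l = 1 := by omega
        revert i; decide
    -- Height 2, adjacent across parts only to height 1, takes a fourth colour everywhere.
    · refine ⟨fun i j => if j = 1 then ![0, 1, 0, 1, 2] i else if j = 3 then ![1, 0, 1, 2, 0] i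
        else 3, ?_, ?_, ?_⟩
      · intro i j h1 h2
        have : j = 1 ∨ j = 2 ∨ j = 3 := by omega
        simp only [fT_eq]
        rcases this with rfl | rfl | rfl <;> revert i <;> decide
      · intro i j l h1 h2 h3 h4
        have hj : j = 1 ∨ j = 2 ∨ j = 3 := by omega
        have hl : l = 1 ∨ l = 2 ∨ l = 3 := by omega
        rcases hj with rfl | rfl | rfl <;>
          rcases hl with rfl | rfl | rfl <;> revert i <;> decide
      · intro i j l h1 h2 h3
        have : (j = 1 ∧ l = 1) ∨ (j = 1 ∧ l = 2) ∨ (j = 2 ∧ l = 1) := by omega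
        rcases this with ⟨rfl, rfl⟩ | ⟨rfl, rfl⟩ | ⟨rfl, rfl⟩ <;> revert i <;> decide
  · obtain ⟨n, rfl⟩ : ∃ m, n = m + 4 := ⟨n - 4, by omega⟩
    obtain ⟨c, hlt, hinj, hne⟩ := ih n (by omega)
    have hval : ∀ x y : ZMod 5, fT n + x.val = fT n + y.val → x = y := fun x y h =>
      ZMod.val_injective 5 (Nat.add_left_cancel h)
    -- The two lowest and two highest levels take the five new colours, shifted cyclically by $-2,
    -- 0, 1, -1$. The middle levels drop by 2, which turns $j+l\le n+4$ into $(j-2)+(l-2)\le n$. A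
    -- top level meets a neighbouring part only in the pair $(1,n+3)$.
    obtain ⟨d, hd⟩ : ∃ d : ZMod 5 → ℕ → ℕ, ∀ i j, 1 ≤ j → j ≤ n + 4 →
        (j = 1 ∧ d i j = fT n + (i - 2).val) ∨ (j = 2 ∧ d i j = fT n + i.val) ∨
        (j = n + 3 ∧ d i j = fT n + (i + 1).val) ∨ (j = n + 4 ∧ d i j = fT n + (i - 1).val) ∨
        (3 ≤ j ∧ j ≤ n + 2 ∧ d i j = c i (j - 2)) := by
      refine ⟨fun i j => if j = 1 then fT n + (i - 2).val else if j = 2 then fT n + i.val else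
        if j = n + 3 then fT n + (i + 1).val else if j = n + 4 then fT n + (i - 1).val else
        c i (j - 2), fun i j h1 h2 => ?_⟩
      dsimp only
      split_ifs with a1 a2 a3 a4
      · exact .inl ⟨a1, rfl⟩
      · exact .inr (.inl ⟨a2, rfl⟩)
      · exact .inr (.inr (.inl ⟨a3, rfl⟩))
      · exact .inr (.inr (.inr (.inl ⟨a4, rfl⟩)))
      · exact .inr (.inr (.inr (.inr ⟨by omega, by omega, rfl⟩)))
    refine ⟨d, ?_, ?_, ?_⟩
    · intro i j h1 h2
      have hv : ∀ x : ZMod 5, fT n + x.val < fT n + 5 := fun x =>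
        Nat.add_lt_add_left (ZMod.val_lt x) _
      rw [fT_add_four]
      rcases hd i j h1 h2 with ⟨-, h⟩ | ⟨-, h⟩ | ⟨-, h⟩ | ⟨-, h⟩ | ⟨_, _, h⟩
      iterate 4 exact h ▸ hv _
      have := hlt i (j - 2)
      omega
    · intro i j l h1 h2 h3 h4 he
      have hj := hlt i (j - 2)
      have hl := hlt i (l - 2)
      have := hinj i (j - 2) (l - 2)
      have hl' := hd i l h3 h4
      rcases hd i j h1 h2 with ⟨_, h⟩ | ⟨_, h⟩ | ⟨_, h⟩ | ⟨_, h⟩ | ⟨_, _, h⟩ <;>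
        rcases hl' with ⟨_, h'⟩ | ⟨_, h'⟩ | ⟨_, h'⟩ | ⟨_, h'⟩ | ⟨_, _, h'⟩ <;>
        first
        | omega
        | exact absurd (hval _ _ (h.symm.trans (he.trans h'))) (by clear * -; revert i; decide)
    · intro i j l h1 h3 hjl he
      have hj := hlt i (j - 2)
      have hl := hlt (i + 1) (l - 2)
      have := hne i (j - 2) (l - 2)
      have hl' := hd (i + 1) l h3 (by omega)
      rcases hd i j h1 (by omega) with ⟨_, h⟩ | ⟨_, h⟩ | ⟨_, h⟩ | ⟨_, h⟩ | ⟨_, _, h⟩ <;>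
        rcases hl' with ⟨_, h'⟩ | ⟨_, h'⟩ | ⟨_, h'⟩ | ⟨_, h'⟩ | ⟨_, _, h'⟩ <;>
        first
        | omega
        | exact absurd (hval _ _ (h.symm.trans (he.trans h'))) (by clear * -; revert i; decide)

/-! ### Cycle homomorphisms and weighted edge covers of a cycle. -/

section Cyclic

variable {k : ℕ}

theorem val_add_one_eq (hk : 4 ≤ k) (i : ZMod k) :
    (i + 1).val = if i.val + 1 = k then 0 else i.val + 1 := by
  have : NeZero k := ⟨by omega⟩
  have : Fact (1 < k) := ⟨by omega⟩
  have hi := ZMod.val_lt i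
  rw [ZMod.val_add, ZMod.val_one]
  split_ifs with h
  · rw [h, Nat.mod_self]
  · exact Nat.mod_eq_of_lt (by omega)

theorem cyclic_induction [NeZero k] {P : ZMod k → Prop} (i : ZMod k) (hi : P i)
    (hP : ∀ j, P j → P (j + 1)) (j : ZMod k) : P j := by
  have h : ∀ m : ℕ, P (i + m) := by
    intro m
    induction m with
    | zero => simpa using hi
    | succ m ih => simpa [add_assoc] using hP _ ih
  simpa using h (j - i).val

theorem add_one_ne (hk : 4 ≤ k) (i : ZMod k) : i + 1 ≠ i := by
  have : Fact (1 < k) := ⟨by omega⟩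
  simp

theorem sub_one_ne (hk : 4 ≤ k) (i : ZMod k) : i - 1 ≠ i := by
  have := add_one_ne hk (i - 1)
  rw [sub_add_cancel] at this
  exact this.symm

/-- A homomorphism from the `k`-cycle to the `5`-cycle. -/
theorem exists_cycle_hom (hk : 4 ≤ k) :
    ∃ g : ZMod k → ZMod 5, ∀ i, g (i + 1) = g i + 1 ∨ g i = g (i + 1) + 1 := by
  have : NeZero k := ⟨by omega⟩
  -- Even cycles fold onto the edge $01$; odd ones run $0,1,2$, then alternate $3,4$ and return from
  -- $4$ to $0$.
  let G : ℕ → ℕ := fun v => if k % 2 = 0 then v % 2 else if v < 3 then v else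
    if v % 2 = 0 then 4 else 3
  refine ⟨fun i => (G i.val : ZMod 5), fun i => ?_⟩
  have h : G (i + 1).val = G i.val + 1 ∨ G i.val = G (i + 1).val + 1 ∨
      (G i.val = 4 ∧ G (i + 1).val = 0) := by
    rw [val_add_one_eq hk]
    have := ZMod.val_lt i
    simp only [G]
    split_ifs <;> omega
  rcases h with h | h | ⟨h, h'⟩
  · left; simp [h]
  · right; simp [h]
  · left; dsimp only; rw [h, h']; decide

theorem sum_range_alternate (a b m : ℕ) :
    ∑ v ∈ Finset.range m, (if v % 2 = 0 then a else b) = (m + 1) / 2 * a + m / 2 * b := by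
  induction m with
  | zero => simp
  | succ m ih =>
    rw [Finset.sum_range_succ, ih]
    split_ifs with h
    · have h1 : (m + 1 + 1) / 2 = (m + 1) / 2 + 1 := by omega
      have h2 : (m + 1) / 2 = m / 2 := by omega
      rw [h1, h2]; ring
    · have h1 : (m + 1 + 1) / 2 = (m + 1) / 2 := by omega
      have h2 : (m + 1) / 2 = m / 2 + 1 := by omega
      rw [h1, h2]; ring

theorem sum_val_eq_sum_range [NeZero k] (f : ℕ → ℕ) :
    ∑ i : ZMod k, f i.val = ∑ v ∈ Finset.range k, f v := by
  obtain ⟨m, rfl⟩ : ∃ m, k = m + 1 := ⟨k - 1, by have := NeZero.ne k; omega⟩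
  exact Fin.sum_univ_eq_sum_range f (m + 1)

/-- An edge cover of the cycle with constant vertex weights. -/
theorem exists_edge_cover_const [NeZero k] (hk : 4 ≤ k) (c n : ℕ)
    (hS : ∀ S : Finset (ZMod k), (∀ i ∈ S, i + 1 ∉ S) → ∑ _i ∈ S, c ≤ n) :
    ∃ y : ZMod k → ℕ, (∀ i, c ≤ y i + y (i - 1)) ∧ ∑ i, y i ≤ fT n := by
  have hle : k / 2 * c ≤ n := by
    -- The even positions, without $k-1$, which is adjacent to $0$: a stable set of size $\lfloor
    -- k/2\rfloor$.
    have h := hS (Finset.univ.filter fun i => i.val % 2 = 0 ∧ i.val + 1 < k) (by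
      intro i hi
      have := val_add_one_eq hk i
      simp only [Finset.mem_filter, Finset.mem_univ, true_and] at hi ⊢
      rw [this]
      split_ifs <;> omega)
    rw [Finset.sum_filter,
      sum_val_eq_sum_range fun v => if v % 2 = 0 ∧ v + 1 < k then c else 0] at h
    obtain ⟨m, rfl⟩ : ∃ m, k = m + 1 := ⟨k - 1, by omega⟩
    rw [Finset.sum_range_succ, if_neg (by omega), add_zero] at h
    have h' : ∑ v ∈ Finset.range m, (if v % 2 = 0 ∧ v + 1 < m + 1 then c else 0) =
        ∑ v ∈ Finset.range m, (if v % 2 = 0 then c else 0) := by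
      refine Finset.sum_congr rfl fun v hv => ?_
      have := Finset.mem_range.1 hv
      simp [this]
    rw [h', sum_range_alternate] at h
    simpa using h
  -- For odd $k$ the edges $k-1$ and $0$ both carry the larger half, so the excess over $\lfloor
  -- k/2\rfloor c$ is at most $\lceil c/2\rceil$, with $c\le n/2$.
  refine ⟨fun i => if i.val % 2 = 0 then (c + 1) / 2 else c / 2, fun i => ?_, ?_⟩
  · have := val_add_one_eq hk (i - 1)
    rw [sub_add_cancel] at this
    dsimp only
    rw [this]
    split_ifs <;> omega
  · rw [sum_val_eq_sum_range fun v => if v % 2 = 0 then (c + 1) / 2 else c / 2,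
      sum_range_alternate, fT_eq]
    obtain ⟨t, ht⟩ : ∃ t, t = k / 2 := ⟨_, rfl⟩
    have h2 : 2 * c ≤ n := le_trans (Nat.mul_le_mul_right c (by omega)) hle
    have h3 : (k + 1) / 2 * ((c + 1) / 2) ≤ (k / 2 + 1) * ((c + 1) / 2) :=
      Nat.mul_le_mul_right _ (by omega)
    have h4 : k / 2 * ((c + 1) / 2) + k / 2 * (c / 2) = k / 2 * c := by
      rw [← mul_add]; congr 1; omega
    rw [add_mul, one_mul] at h3
    omega

/-- If every stable set of the `k`-cycle has weight at most `n`, then the weights are covered by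
`fT n` edges. -/
theorem exists_edge_cover [NeZero k] (hk : 4 ≤ k) (w : ZMod k → ℕ) (n : ℕ)
    (hS : ∀ S : Finset (ZMod k), (∀ i ∈ S, i + 1 ∉ S) → ∑ i ∈ S, w i ≤ n) :
    ∃ y : ZMod k → ℕ, (∀ i, w i ≤ y i + y (i - 1)) ∧ ∑ i, y i ≤ fT n := by
  induction hN : ∑ i, w i using Nat.strong_induction_on generalizing w n with
  | _ N ih =>
  -- If every stable set of weight $n$ meets the edge $\{a,a+1\}$ in positive weight, one copy of
  -- that edge lowers the bound to $n-1$, and $f_T$ drops by at least the one edge spent.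
  have reduce : ∀ a, 0 < w a → (∀ S : Finset (ZMod k), (∀ i ∈ S, i + 1 ∉ S) →
      (∃ b ∈ S, (b = a ∨ b = a + 1) ∧ 0 < w b) ∨ ∑ i ∈ S, w i < n) →
      ∃ y : ZMod k → ℕ, (∀ i, w i ≤ y i + y (i - 1)) ∧ ∑ i, y i ≤ fT n := by
    intro a ha hcov
    have hn : 1 ≤ n := by
      have := hS {a} (by simpa using fun h => add_one_ne hk a (by simpa using h))
      rw [Finset.sum_singleton] at this
      omega
    let w' : ZMod k → ℕ := fun i => if i = a ∨ i = a + 1 then w i - 1 else w i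
    have hle : ∀ i, w' i ≤ w i := fun i => by
      simp only [w']; split_ifs <;> omega
    have hlt : ∀ b, (b = a ∨ b = a + 1) → 0 < w b → w' b < w b := fun b hb hb' => by
      simp only [w', if_pos hb]; omega
    obtain ⟨y, hy, hsum⟩ := ih (∑ i, w' i)
      (hN ▸ Finset.sum_lt_sum (fun i _ => hle i) ⟨a, Finset.mem_univ _, hlt a (.inl rfl) ha⟩)
      w' (n - 1) (by
        intro S hS'
        rcases hcov S hS' with ⟨b, hb, hb', hb''⟩ | h
        · have h1 := Finset.sum_lt_sum (fun i (_ : i ∈ S) => hle i) ⟨b, hb, hlt b hb' hb''⟩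
          have h2 := hS S hS'
          omega
        · have h1 := Finset.sum_le_sum (fun i (_ : i ∈ S) => hle i)
          omega) rfl
    refine ⟨fun i => y i + if i = a then 1 else 0, fun i => ?_, ?_⟩
    · have h := hy i
      simp only [w'] at h
      dsimp only
      by_cases h1 : i = a
      · simp only [h1, true_or, if_true] at h ⊢
        omega
      · by_cases h2 : i = a + 1
        · simp only [h2, or_true, if_true, add_sub_cancel_right, add_one_ne hk a, if_false] at h ⊢
          omega
        · rw [if_neg (by tauto)] at h
          omega
    · rw [Finset.sum_add_distrib]
      have := fT_lt_fT_succ (n - 1)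
      rw [Nat.sub_add_cancel hn] at this
      simp only [Finset.sum_ite_eq', Finset.mem_univ, if_true]
      omega
  by_cases hzero : ∃ i, w i = 0
  · obtain ⟨i, hi⟩ := hzero
    by_cases hstep : ∀ j, w j = 0 → w (j + 1) = 0
    · have hall := cyclic_induction (P := fun j => w j = 0) i hi hstep
      exact ⟨fun _ => 0, fun j => by simp [hall j], by simp⟩
    · push Not at hstep
      obtain ⟨j, hj, hj'⟩ := hstep
      -- At a zero followed by a positive weight, a stable set missing the edge $\{j+1,j+2\}$ can
      -- gain $j+1$ at no cost: the vertices it gives up, $j$ and $j+2$, contribute nothing. So it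
      -- was not of weight $n$.
      refine reduce (j + 1) (by omega) fun S hS' => ?_
      by_contra! hcon
      obtain ⟨hcon, hge⟩ := hcon
      have hmem : j + 1 ∉ S := fun h => hj' (by have := hcon _ h (.inl rfl); omega)
      have hT := hS (insert (j + 1) ((S.erase j).erase (j + 1 + 1))) (by
        intro i hi hi'
        simp only [Finset.mem_insert, Finset.mem_erase] at hi hi'
        rcases hi with rfl | ⟨h1, h2, h3⟩
        · rcases hi' with h | ⟨h, -⟩
          · exact add_one_ne hk _ h
          · exact h rfl
        · rcases hi' with h | ⟨-, -, h⟩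
          · exact h2 (add_right_cancel h)
          · exact hS' _ h3 h)
      rw [Finset.sum_insert (by simp [hmem])] at hT
      have h1 : ∑ i ∈ (S.erase j).erase (j + 1 + 1), w i = ∑ i ∈ S, w i := by
        refine Finset.sum_subset ((Finset.erase_subset _ _).trans (Finset.erase_subset _ _)) ?_
        intro x hx hx'
        by_cases h2 : x = j
        · rw [h2, hj]
        · by_cases h3 : x = j + 1 + 1
          · have := hcon x hx (.inr h3)
            omega
          · exact absurd (by simp [h2, h3, hx]) hx'
      omega
  · have hpos : ∀ i, 0 < w i := fun i => Nat.pos_of_ne_zero fun h => hzero ⟨i, h⟩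
    by_cases hhit : ∃ a, ∀ S : Finset (ZMod k), (∀ i ∈ S, i + 1 ∉ S) →
        (∃ b ∈ S, (b = a ∨ b = a + 1) ∧ 0 < w b) ∨ ∑ i ∈ S, w i < n
    · obtain ⟨a, ha⟩ := hhit
      exact reduce a (hpos a) ha
    · push Not at hhit
      -- A stable set of weight at least $n$ avoids $a$ and $a+1$; trading $a+2$ for $a+1$ cannot
      -- increase its weight. Monotone around a cycle means constant.
      have hmono : ∀ a, w (a + 1) ≤ w (a + 1 + 1) := by
        intro a
        obtain ⟨S, hS', hmiss, hge⟩ := hhit a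
        have ha : a ∉ S := fun h => by have := hmiss _ h (.inl rfl); have := hpos a; omega
        have ha' : a + 1 ∉ S := fun h => by
          have := hmiss _ h (.inr rfl); have := hpos (a + 1); omega
        have hT := hS (insert (a + 1) (S.erase (a + 1 + 1))) (by
          intro i hi hi'
          simp only [Finset.mem_insert, Finset.mem_erase] at hi hi'
          rcases hi with rfl | ⟨h1, h2⟩
          · rcases hi' with h | ⟨h, -⟩
            · exact add_one_ne hk _ h
            · exact h rfl
          · rcases hi' with h | ⟨-, h⟩
            · exact ha (add_right_cancel h ▸ h2)
            · exact hS' _ h2 h)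
        rw [Finset.sum_insert (by simp [ha'])] at hT
        by_cases h : a + 1 + 1 ∈ S
        · have := Finset.sum_erase_add S w h
          omega
        · rw [Finset.erase_eq_of_notMem h] at hT
          have := hpos (a + 1)
          omega
      have hmono' : ∀ j, w j ≤ w (j + 1) := fun j => by
        have := hmono (j - 1)
        rwa [sub_add_cancel] at this
      have hle : ∀ i j, w i ≤ w j := fun i j =>
        cyclic_induction (P := fun j => w i ≤ w j) i le_rfl (fun j h => h.trans (hmono' j)) j
      have hw : w = fun _ => w 0 := funext fun i => le_antisymm (hle _ _) (hle _ _)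
      obtain ⟨y, hy, hsum⟩ := exists_edge_cover_const hk (w 0) n (by rw [hw] at hS; exact hS)
      exact ⟨y, fun i => (hle i 0).trans (hy i), hsum⟩

end Cyclic

/-! ### Colouring rings and adding simplicial vertices. -/

section Rings

variable {V : Type u} {G : SimpleGraph V} {k : ℕ}

/-- A graph whose vertices have a cyclic index and a height, such that neighbours in consecutive
parts have heights adding up to at most `n`, is `fT n`-colourable. -/
theorem colorable_of_heights (hk : 4 ≤ k) (n : ℕ) (idx : V → ZMod k) (p : V → ℕ)
    (hadj : ∀ v v', G.Adj v v' → idx v' = idx v ∨ idx v' = idx v + 1 ∨ idx v = idx v' + 1)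
    (hinj : ∀ v v', idx v = idx v' → p v = p v' → v = v')
    (hpos : ∀ v, 1 ≤ p v) (hle : ∀ v, p v ≤ n)
    (hsum : ∀ v v', G.Adj v v' → idx v' = idx v + 1 → p v + p v' ≤ n) :
    G.Colorable (fT n) := by
  obtain ⟨c, hc, hc', hne⟩ := exists_coloring_staircase n
  obtain ⟨g, hg⟩ := exists_cycle_hom hk
  have key : ∀ v v', G.Adj v v' → idx v' = idx v + 1 →
      c (g (idx v)) (p v) ≠ c (g (idx v')) (p v') := by
    intro v v' h hi
    have hs := hsum v v' h hi
    -- The homomorphism may reverse an edge; this is harmless because $j+l\le n$ is symmetric.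
    rcases hg (idx v) with h' | h'
    · rw [hi, h']
      exact hne _ _ _ (hpos v) (hpos v') hs
    · rw [hi, h']
      exact (hne _ _ _ (hpos v') (hpos v) (by omega)).symm
  refine ⟨Coloring.mk (fun v => ⟨c (g (idx v)) (p v), hc _ _ (hpos v) (hle v)⟩) ?_⟩
  intro v v' h he
  have he : c (g (idx v)) (p v) = c (g (idx v')) (p v') := Fin.ext_iff.1 he
  rcases hadj v v' h with hi | hi | hi
  · rw [hi] at he
    exact h.ne (hinj v v' hi.symm (hc' _ _ _ (hpos v) (hle v) (hpos v') (hle v') he))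
  · exact key v v' h hi he
  · exact key v' v h.symm hi he.symm

theorem IsCyclicPartition.exists_index {X : ZMod k → Set V} (hX : IsCyclicPartition X) :
    ∃ idx : V → ZMod k, ∀ v i, v ∈ X i ↔ idx v = i := by
  have h : ∀ v, ∃ i, v ∈ X i := fun v => by
    have : v ∈ ⋃ i, X i := hX.cover ▸ Set.mem_univ v
    simpa using this
  choose idx hidx using h
  refine ⟨idx, fun v i => ⟨fun hv => ?_, fun hv => hv ▸ hidx v⟩⟩
  by_contra hne
  exact Set.disjoint_left.1 (hX.disjoint _ _ hne) (hidx v) hv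

theorem IsRing.colorable [Finite V] (h : IsRing k G) : G.Colorable (fT G.cliqueNum) := by
  classical
  obtain ⟨hk, X, hX, hring⟩ := h
  obtain ⟨idx, hidx⟩ := hX.exists_index
  choose m u hu hrange hlast hanti htop using hring
  have hpos : ∀ v, ∃ j, u (idx v) j = v := fun v => by
    have : v ∈ X (idx v) := (hidx v _).2 rfl
    rw [← hrange] at this
    exact this
  choose p hp using hpos
  have hui : ∀ i j, idx (u i j) = i := fun i j => by
    rw [← hidx, ← hrange]
    exact ⟨j, rfl⟩
  have hclq : ∀ i j j', j ≠ j' → G.Adj (u i j) (u i j') := by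
    intro i j j' hne
    have h1 : u i j' ∈ X i := (hidx _ _).2 (hui i j')
    have h2 := hanti i (Fin.le_last j) (hlast i h1)
    rcases h2 with h2 | h2
    · exact absurd (hu i h2).symm hne
    · exact h2
  -- Nested neighbourhoods: an edge between different parts persists when either end moves to an
  -- earlier vertex.
  have hcross : ∀ i i' j l j' l', i ≠ i' → j' ≤ j → l' ≤ l → G.Adj (u i j) (u i' l) →
      G.Adj (u i j') (u i' l') := by
    intro i i' j l j' l' hii hj hl hadj
    have hne : ∀ a b, u i a ≠ u i' b := fun a b hab => hii (by rw [← hui i a, hab, hui])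
    have h1 : G.Adj (u i j') (u i' l) :=
      (hanti i hj (Set.mem_insert_of_mem _ hadj)).resolve_left (hne _ _).symm
    exact ((hanti i' hl (Set.mem_insert_of_mem _ h1.symm)).resolve_left (hne _ _)).symm
  -- `Fin` positions start at 0, heights at 1, so the height counts the initial segment ending at
  -- `v`.
  refine colorable_of_heights hk _ idx (fun v => (p v : ℕ) + 1) ?_ ?_ (fun _ => by omega) ?_ ?_
  · intro v v' hadj
    have h1 : v' ∈ closedNbhd G (u (idx v) 0) := by
      refine hanti (idx v) (Fin.zero_le (p v)) ?_
      dsimp only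
      rw [hp]
      exact Set.mem_insert_of_mem _ hadj
    rw [htop] at h1
    simp only [Set.mem_union, hidx] at h1
    rcases h1 with (h1 | h1) | h1
    · exact .inr (.inr (by rw [h1, sub_add_cancel]))
    · exact .inl h1
    · exact .inr (.inl h1)
  · intro v v' hi hpp
    rw [← hp v, ← hp v']
    have : ∀ i (hi : i = idx v') (a : Fin (m i + 1)), (a : ℕ) = p v' →
        u i a = u (idx v') (p v') := by
      rintro i rfl a ha
      rw [Fin.ext ha]
    exact this _ hi _ (by simpa using hpp)
  · intro v
    have hcl : G.IsClique ((Finset.Iic (p v)).image (u (idx v)) : Finset V) := by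
      intro x hx y hy hxy
      simp only [Finset.coe_image, Set.mem_image] at hx hy
      obtain ⟨a, -, rfl⟩ := hx
      obtain ⟨b, -, rfl⟩ := hy
      exact hclq _ _ _ fun hab => hxy (by rw [hab])
    have := hcl.card_le_cliqueNum
    rwa [Finset.card_image_of_injective _ (hu _), Fin.card_Iic] at this
  · intro v v' hadj hi
    have hne : idx v ≠ idx v' := fun h => add_one_ne hk (idx v) (by rw [← hi, ← h])
    have hcl : G.IsClique ((Finset.Iic (p v)).image (u (idx v)) ∪
        (Finset.Iic (p v')).image (u (idx v')) : Finset V) := by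
      have hc : ∀ a ≤ p v, ∀ b ≤ p v', G.Adj (u (idx v) a) (u (idx v') b) := fun a ha b hb =>
        hcross _ _ _ _ _ _ hne ha hb (by rwa [hp, hp])
      intro x hx y hy hxy
      simp only [Finset.coe_union, Finset.coe_image, Set.mem_union, Set.mem_image,
        Finset.coe_Iic, Set.mem_Iic] at hx hy
      rcases hx with ⟨a, ha, rfl⟩ | ⟨a, ha, rfl⟩ <;> rcases hy with ⟨b, hb, rfl⟩ | ⟨b, hb, rfl⟩
      · exact hclq _ _ _ fun hab => hxy (by rw [hab])
      · exact hc a ha b hb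
      · exact (hc b hb a ha).symm
      · exact hclq _ _ _ fun hab => hxy (by rw [hab])
    have := hcl.card_le_cliqueNum
    rw [Finset.card_union_of_disjoint, Finset.card_image_of_injective _ (hu _),
      Finset.card_image_of_injective _ (hu _), Fin.card_Iic, Fin.card_Iic] at this
    · omega
    · rw [Finset.disjoint_left]
      intro x hx hx'
      simp only [Finset.mem_image] at hx hx'
      obtain ⟨a, -, rfl⟩ := hx
      obtain ⟨b, -, hb⟩ := hx'
      exact hne (by rw [← hui (idx v) a, ← hb, hui])

/-- Greedy colouring along simplicial vertices. -/
theorem colorable_of_forall_induce [Finite V] (m : ℕ) (hm : G.cliqueNum ≤ m)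
    (h : ∀ S : Set V, S.Nonempty → (G.induce S).Colorable m ∨ ∃ v, IsSimplicial (G.induce S) v) :
    G.Colorable m := by
  classical
  have := Fintype.ofFinite V
  have key : ∀ N, ∀ S : Set V, S.ncard = N → (G.induce S).Colorable m := by
    intro N
    induction N using Nat.strong_induction_on with
    | _ N ih =>
    intro S hS
    rcases S.eq_empty_or_nonempty with rfl | hne
    · exact Colorable.of_isEmpty m
    rcases h S hne with hcol | ⟨⟨v, hv⟩, hsimp⟩
    · exact hcol
    obtain ⟨C⟩ := ih (S \ {v}).ncard
      (hS ▸ Set.ncard_sdiff_singleton_lt_of_mem hv) (S \ {v}) rfl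
    have hmem : ∀ x : S, (x : V) ≠ v → (x : V) ∈ S \ {v} := fun x hx => ⟨x.2, hx⟩
    let N : Finset V := Finset.univ.filter fun x => x ∈ S ∧ G.Adj v x
    -- A simplicial vertex and its neighbours form a clique, so at most $m-1$ colours are blocked at
    -- `v`.
    have hN : G.IsClique (insert v N : Finset V) := by
      rw [Finset.coe_insert, isClique_insert]
      refine ⟨?_, fun b hb _ => by simpa [N] using (Finset.mem_filter.1 hb).2.2⟩
      intro a ha b hb hab
      have ha' : a ∈ S ∧ G.Adj v a := by simpa [N] using ha
      have hb' : b ∈ S ∧ G.Adj v b := by simpa [N] using hb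
      exact hsimp (x := ⟨a, ha'.1⟩) ha'.2 (y := ⟨b, hb'.1⟩) hb'.2 (by simpa using hab)
    have hcard := hN.card_le_cliqueNum
    rw [Finset.card_insert_of_notMem (by simp [N])] at hcard
    let used : Finset (Fin m) := N.attach.image fun x : {x // x ∈ N} =>
      C ⟨x, (Finset.mem_filter.1 x.2).2.1, (Finset.mem_filter.1 x.2).2.2.ne'⟩
    have hused : used.card < Fintype.card (Fin m) := by
      have : used.card ≤ N.attach.card := Finset.card_image_le
      rw [Finset.card_attach] at this
      rw [Fintype.card_fin]
      omega
    obtain ⟨c, hc⟩ : ∃ c, c ∉ used := by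
      by_contra! hall
      exact hused.ne (by rw [Finset.eq_univ_of_forall hall, Finset.card_univ])
    have hfree : ∀ (x : V) (hx : x ∈ S \ {v}), G.Adj v x → C ⟨x, hx⟩ ≠ c := by
      intro x hx hadj he
      refine hc (Finset.mem_image.2 ⟨⟨x, by simp [N, hx.1, hadj]⟩, Finset.mem_attach _ _, he⟩)
    refine ⟨Coloring.mk (fun x : S => if hx : (x : V) = v then c else C ⟨x, hmem x hx⟩) ?_⟩
    intro x y hxy
    have hxy' : G.Adj (x : V) y := hxy
    by_cases hx : (x : V) = v <;> by_cases hy : (y : V) = v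
    · exact absurd (hx.trans hy.symm) hxy'.ne
    · simp only [hx, hy, dite_true, dite_false]
      exact (hfree _ (hmem y hy) (hx ▸ hxy')).symm
    · simp only [hx, hy, dite_true, dite_false]
      exact hfree _ (hmem x hx) (hy ▸ hxy'.symm)
    · simp only [hx, hy, dite_false]
      exact C.valid (show G.Adj (x : V) y from hxy')
  exact ((key _ Set.univ rfl).of_hom (induceUnivIso G).symm.toHom)

theorem isChiBounding_ringClassGE : IsChiBounding (ringClassGE.{u} 4) fT := by
  rintro V G ⟨k, -, hfin, -, h⟩
  refine Colorable.chromaticNumber_le (colorable_of_forall_induce _ (le_fT _) fun S hS => ?_)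
  rcases h S hS with h' | h'
  · exact .inl (h'.colorable.mono (fT_strictMono.monotone (cliqueNum_induce_le S)))
  · exact .inr h'

end Rings

/-! ### Closure under induced subgraphs. -/

section Hereditary

theorem isHereditary_hyperholeClassGE (k : ℕ) : IsHereditary (hyperholeClassGE.{u} k) := by
  rintro V W G H ⟨i, hi, hfin, -, U, K, hU, hK, hG⟩ hW hH
  obtain ⟨f⟩ := hH
  exact ⟨i, hi, Finite.of_injective f f.injective, hW, U, K, hU, hK, IsIndContained.trans ⟨f⟩ hG⟩

theorem isHereditary_hyperantiholeClassGE (k : ℕ) :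
    IsHereditary (hyperantiholeClassGE.{u} k) := by
  rintro V W G H ⟨i, hi, hfin, -, U, K, hU, hK, hG⟩ hW hH
  obtain ⟨f⟩ := hH
  exact ⟨i, hi, Finite.of_injective f f.injective, hW, U, K, hU, hK, IsIndContained.trans ⟨f⟩ hG⟩

variable {V : Type u} {W : Type v} {G : SimpleGraph V} {H : SimpleGraph W} {k : ℕ}

theorem closedNbhd_iso (e : G ≃g H) (x : V) : closedNbhd H (e x) = e '' closedNbhd G x := by
  ext y
  obtain ⟨y, rfl⟩ := e.surjective y
  rw [e.injective.mem_set_image]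
  simp [closedNbhd, e.map_adj_iff]

theorem IsRing.of_iso (h : IsRing k G) (e : G ≃g H) : IsRing k H := by
  obtain ⟨hk, X, ⟨hne, hdisj, hcov⟩, hring⟩ := h
  refine ⟨hk, fun i => e '' X i, ⟨fun i => (hne i).image e,
    fun i j hij => (Set.disjoint_image_iff e.injective).2 (hdisj i j hij), ?_⟩, fun i => ?_⟩
  · rw [← Set.image_iUnion, hcov, Set.image_univ_of_surjective e.surjective]
  · obtain ⟨m, u, hu, hr, hl, ha, ht⟩ := hring i
    refine ⟨m, e ∘ u, e.injective.comp hu, by rw [Set.range_comp, hr], ?_, ?_, ?_⟩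
    · rw [Function.comp_apply, closedNbhd_iso]
      exact Set.image_mono hl
    · intro a b hab
      simp only [Function.comp_apply, closedNbhd_iso]
      exact Set.image_mono (ha hab)
    · rw [Function.comp_apply, closedNbhd_iso, ht, Set.image_union, Set.image_union]

theorem IsSimplicial.of_iso {x : V} (h : IsSimplicial G x) (e : G ≃g H) :
    IsSimplicial H (e x) := by
  intro a ha b hb hab
  obtain ⟨a, rfl⟩ := e.surjective a
  obtain ⟨b, rfl⟩ := e.surjective b
  rw [mem_neighborSet, e.map_adj_iff] at ha hb
  exact e.map_adj_iff.2 (h ha hb fun hab' => hab (hab' ▸ rfl))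

theorem isHereditary_ringClassGE (k : ℕ) : IsHereditary (ringClassGE.{u} k) := by
  rintro V W G H ⟨i, hi, hfin, -, h⟩ hW ⟨f⟩
  refine ⟨i, hi, Finite.of_injective f f.injective, hW, fun S hS => ?_⟩
  let e : H.induce S ≃g G.induce (f '' S) :=
    { toEquiv := Equiv.Set.image f S f.injective
      map_rel_iff' := f.map_adj_iff }
  rcases h _ (hS.image f) with h' | ⟨v, hv⟩
  · exact .inl (h'.of_iso e.symm)
  · exact .inr ⟨_, hv.of_iso e.symm⟩

end Hereditary

/-! ### Hyperholes inside the class of rings. -/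

section Hyperholes

variable {V : Type u} {W : Type v} {G : SimpleGraph V} {H : SimpleGraph W} {k : ℕ}

theorem IsHyperhole.exists_index (h : IsHyperhole k H) : ∃ idx : W → ZMod k,
    ∀ a b, H.Adj a b ↔ a ≠ b ∧ (idx b = idx a - 1 ∨ idx b = idx a ∨ idx b = idx a + 1) := by
  obtain ⟨-, X, hX, hclq, hcomp, hanti⟩ := h
  obtain ⟨idx, hidx⟩ := hX.exists_index
  have hmem : ∀ a, a ∈ X (idx a) := fun a => (hidx a _).2 rfl
  refine ⟨idx, fun a b => ⟨fun hab => ⟨hab.ne, ?_⟩, ?_⟩⟩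
  · by_contra! hne
    refine hanti (idx a) a (hmem a) b ?_ hab
    simp only [Set.mem_compl_iff, Set.mem_union, hidx]
    tauto
  · rintro ⟨hne, h | h | h⟩
    · exact hcomp (idx a) a (hmem a) b (.inl ((hidx _ _).2 h))
    · exact hclq (idx a) (hmem a) ((hidx _ _).2 h) hne
    · exact hcomp (idx a) a (hmem a) b (.inr ((hidx _ _).2 h))

/-- A finite nonnull induced subgraph of a `k`-hyperhole is a `k`-ring or has a simplicial
vertex. -/
theorem IsHyperhole.isRing_or_isSimplicial [Finite V] [Nonempty V] (h : IsHyperhole k H)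
    (hG : G ⊴ H) : IsRing k G ∨ ∃ v, IsSimplicial G v := by
  have hk := h.1
  have : NeZero k := ⟨by omega⟩
  obtain ⟨f⟩ := hG
  obtain ⟨idx', hidx'⟩ := h.exists_index
  obtain ⟨idx, hadj⟩ : ∃ idx : V → ZMod k, ∀ a b, G.Adj a b ↔
      a ≠ b ∧ (idx b = idx a - 1 ∨ idx b = idx a ∨ idx b = idx a + 1) :=
    ⟨fun v => idx' (f v), fun a b => by rw [← f.map_adj_iff, hidx', f.injective.ne_iff]⟩
  by_cases hsurj : Function.Surjective idx
  · left
    have hN : ∀ v, closedNbhd G v =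
        {x | idx x = idx v - 1} ∪ {x | idx x = idx v} ∪ {x | idx x = idx v + 1} := by
      intro v
      ext x
      simp only [closedNbhd, Set.mem_insert_iff, mem_neighborSet, hadj, Set.mem_union,
        Set.mem_ofPred_eq]
      by_cases hx : x = v
      · simp [hx]
      · have := Ne.symm hx
        tauto
    refine ⟨hk, fun i => {x | idx x = i}, ⟨fun i => hsurj i, fun i j hij => ?_, ?_⟩, fun i => ?_⟩
    · rw [Set.disjoint_left]
      rintro x rfl hx
      exact hij hx
    · ext x; simp
    -- All vertices of one part have the same closed neighbourhood, so any enumeration works.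
    · obtain ⟨m, ⟨e⟩⟩ := Finite.exists_equiv_fin {x | idx x = i}
      obtain ⟨m, rfl⟩ : ∃ l, m = l + 1 := by
        obtain ⟨x, hx⟩ := hsurj i
        exact ⟨m - 1, by have := (e ⟨x, hx⟩).pos; omega⟩
      have hi : ∀ j, idx (e.symm j) = i := fun j => (e.symm j).2
      refine ⟨m, fun j => e.symm j, Subtype.val_injective.comp e.symm.injective, ?_, ?_, ?_, ?_⟩
      · ext x
        constructor
        · rintro ⟨j, rfl⟩
          exact hi j
        · intro hx
          exact ⟨e ⟨x, hx⟩, by simp⟩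
      · rw [hN, hi]
        exact fun x hx => .inl (.inr hx)
      · intro a b _
        simp only [hN, hi]
        exact le_rfl
      · rw [hN, hi]
  · right
    rw [Function.Surjective] at hsurj
    push Not at hsurj
    obtain ⟨i, hi⟩ := hsurj
    obtain ⟨v₀⟩ := ‹Nonempty V›
    by_cases hstep : ∀ j, (∀ v, idx v ≠ j) → ∀ v, idx v ≠ j + 1
    · exact absurd rfl (cyclic_induction (P := fun j => ∀ v, idx v ≠ j) i hi hstep (idx v₀) v₀)
    · push Not at hstep
      -- An empty part followed by a nonempty one: neighbours of `v` lie in parts $j+1$ and $j+2$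
      -- only, which together form a clique.
      obtain ⟨j, hj, v, hv⟩ := hstep
      refine ⟨v, fun a ha b hb hab => ?_⟩
      have hnb : ∀ x ∈ G.neighborSet v, idx x = j + 1 ∨ idx x = j + 1 + 1 := by
        intro x hx
        have := ((hadj v x).1 hx).2
        rw [hv, add_sub_cancel_right] at this
        exact this.resolve_left (hj x)
      refine (hadj a b).2 ⟨hab, ?_⟩
      rcases hnb a ha with h1 | h1 <;> rcases hnb b hb with h2 | h2 <;> rw [h1, h2] <;> simp

theorem ringClassGE_of_hyperholeClassGE {V : Type u} {G : SimpleGraph V} {k : ℕ}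
    (h : hyperholeClassGE k V G) : ringClassGE k V G := by
  obtain ⟨i, hi, hfin, hne, W, H, -, hH, hG⟩ := h
  refine ⟨i, hi, hfin, hne, fun S hS => ?_⟩
  have := hS.to_subtype
  exact hH.isRing_or_isSimplicial (IsIndContained.trans ⟨Embedding.induce S⟩ hG)

end Hyperholes

/-! ### Hyperantiholes via edge covers. -/

section Hyperantiholes

variable {V : Type u} {W : Type v} {G : SimpleGraph V} {H : SimpleGraph W} {k : ℕ}

theorem IsHyperantihole.exists_index (h : IsHyperantihole k H) : ∃ idx : W → ZMod k,
    ∀ a b, H.Adj a b ↔ a ≠ b ∧ idx b ≠ idx a - 1 ∧ idx b ≠ idx a + 1 := by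
  obtain ⟨-, X, hX, hclq, hcomp, hanti⟩ := h
  obtain ⟨idx, hidx⟩ := hX.exists_index
  have hmem : ∀ a, a ∈ X (idx a) := fun a => (hidx a _).2 rfl
  refine ⟨idx, fun a b => ⟨fun hab => ⟨hab.ne, fun h => ?_, fun h => ?_⟩, ?_⟩⟩
  · exact hanti (idx a) a (hmem a) b (.inl ((hidx _ _).2 h)) hab
  · exact hanti (idx a) a (hmem a) b (.inr ((hidx _ _).2 h)) hab
  · rintro ⟨hne, h1, h2⟩
    by_cases h : idx b = idx a
    · exact hclq (idx a) (hmem a) ((hidx _ _).2 h) hne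
    · refine hcomp (idx a) a (hmem a) b ?_
      simp only [Set.mem_compl_iff, Set.mem_union, hidx]
      tauto

/-- A colour attached to the edge $\{j,j+1\}$ may serve one vertex of each of these two anticomplete
parts. Colouring thus reduces to covering the part sizes by edges, and the stable-set hypothesis of
`exists_edge_cover` is the clique bound. -/
theorem IsHyperantihole.colorable [Finite V] (h : IsHyperantihole k H) (hG : G ⊴ H) :
    G.Colorable (fT G.cliqueNum) := by
  classical
  have := Fintype.ofFinite V
  have hk := h.1
  have : NeZero k := ⟨by omega⟩
  obtain ⟨f⟩ := hG
  obtain ⟨idx', hidx'⟩ := h.exists_index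
  obtain ⟨idx, hadj⟩ : ∃ idx : V → ZMod k, ∀ a b, G.Adj a b ↔
      a ≠ b ∧ idx b ≠ idx a - 1 ∧ idx b ≠ idx a + 1 :=
    ⟨fun v => idx' (f v), fun a b => by rw [← f.map_adj_iff, hidx', f.injective.ne_iff]⟩
  let Y : ZMod k → Finset V := fun i => Finset.univ.filter fun v => idx v = i
  have hY : ∀ i v, v ∈ Y i ↔ idx v = i := fun i v => by simp [Y]
  obtain ⟨y, hy, hsum⟩ := exists_edge_cover hk (fun i => (Y i).card) G.cliqueNum (by
    intro S hS
    rw [← Finset.card_biUnion]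
    · have hclq : G.IsClique (S.biUnion Y : Finset V) := by
        intro a ha b hb hab
        simp only [Finset.coe_biUnion, Set.mem_iUnion, Finset.mem_coe, hY] at ha hb
        obtain ⟨_, ha, rfl⟩ := ha
        obtain ⟨_, hb, rfl⟩ := hb
        refine (hadj a b).2 ⟨hab, fun h => ?_, fun h => ?_⟩
        · exact hS _ hb (by rwa [h, sub_add_cancel])
        · exact hS _ ha (h ▸ hb)
      exact hclq.card_le_cliqueNum
    · intro i _ j _ hij
      rw [Function.onFun, Finset.disjoint_left]
      intro v hv hv'
      exact hij (((hY _ _).1 hv).symm.trans ((hY _ _).1 hv')))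
  -- Part $i$ draws on the colours of its two incident edges, indexed $i$ and $i-1$.
  let C : ZMod k → Finset (Σ j, Fin (y j)) := fun i => ({i, i - 1} : Finset (ZMod k)).sigma
    fun _ => Finset.univ
  have hinj : ∀ i, ∃ g : Y i → C i, Function.Injective g := fun i => by
    have hle : (Y i).card ≤ (C i).card := by
      rw [Finset.card_sigma, Finset.sum_pair (sub_one_ne hk i).symm]
      simpa using hy i
    obtain ⟨g⟩ := Function.Embedding.nonempty_of_card_le
      (α := Y i) (β := C i) (by simpa using hle)
    exact ⟨g, g.injective⟩
  choose g hg using hinj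
  have hcol : G.Coloring (Σ j, Fin (y j)) := by
    refine Coloring.mk (fun v => (g (idx v) ⟨v, (hY _ _).2 rfl⟩ : Σ j, Fin (y j))) ?_
    intro a b hab he
    obtain ⟨hne, h1, h2⟩ := (hadj a b).1 hab
    have ha := (g (idx a) ⟨a, (hY _ _).2 rfl⟩).2
    have hb := (g (idx b) ⟨b, (hY _ _).2 rfl⟩).2
    rw [← he] at hb
    simp only [C, Finset.mem_sigma, Finset.mem_insert, Finset.mem_singleton, Finset.mem_univ,
      and_true] at ha hb
    have hidx : idx a = idx b := by
      rcases ha with ha | ha <;> rcases hb with hb | hb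
      · exact ha.symm.trans hb
      · exact absurd (by rw [← ha, hb, sub_add_cancel]) h2
      · exact absurd (by rw [← hb, ha]) h1
      · exact sub_left_injective (ha.symm.trans hb)
    have : ∀ i (hi : idx a = i) (hb : b ∈ Y i),
        (g (idx a) ⟨a, (hY _ _).2 rfl⟩ : Σ j, Fin (y j)) = g i ⟨b, hb⟩ → a = b := by
      rintro i rfl hb h
      exact congrArg Subtype.val (hg _ (Subtype.ext h))
    exact hne (this _ hidx _ he)
  have := hcol.colorable
  simp only [Fintype.card_sigma, Fintype.card_fin] at this
  exact this.mono hsum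

theorem isChiBounding_hyperantiholeClassGE : IsChiBounding (hyperantiholeClassGE.{u} 4) fT := by
  rintro V G ⟨k, -, hfin, -, W, H, -, hH, hG⟩
  exact (hH.colorable hG).chromaticNumber_le

end Hyperantiholes

/-! ### Extremal blowups of the 5-cycle. -/

section Blowup

/-- The graph obtained from the `5`-cycle by replacing the vertex `i` by a clique of size `w i`. -/
def fiveCycleBlowup (w : ZMod 5 → ℕ) : SimpleGraph (ULift.{u} (Σ i, Fin (w i))) where
  Adj a b := a ≠ b ∧ (b.down.1 = a.down.1 - 1 ∨ b.down.1 = a.down.1 ∨ b.down.1 = a.down.1 + 1)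
  symm := ⟨by
    rintro a b ⟨hne, h⟩
    refine ⟨hne.symm, ?_⟩
    rcases h with h | h | h <;> rw [h] <;> simp⟩
  loopless := ⟨fun a h => h.1 rfl⟩

variable {w : ZMod 5 → ℕ}

theorem isCyclicPartition_fiveCycleBlowup (hw : ∀ i, 0 < w i) (σ : Equiv.Perm (ZMod 5)) :
    IsCyclicPartition fun i : ZMod 5 => {a : ULift.{u} (Σ i, Fin (w i)) | a.down.1 = σ i} where
  nonempty i := ⟨⟨⟨σ i, ⟨0, hw _⟩⟩⟩, rfl⟩
  disjoint i j hij := by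
    rw [Set.disjoint_left]
    intro a ha ha'
    exact hij (σ.injective (Eq.trans (Eq.symm ha) ha'))
  cover := by
    ext a
    simpa using ⟨σ.symm a.down.1, by simp⟩

theorem isHyperhole_fiveCycleBlowup (hw : ∀ i, 0 < w i) :
    IsHyperhole 5 (fiveCycleBlowup.{u} w) := by
  refine ⟨by norm_num, _, isCyclicPartition_fiveCycleBlowup hw (Equiv.refl _), ?_, ?_, ?_⟩
  · intro i a ha b hb hab
    exact ⟨hab, .inr (.inl (Eq.trans hb (Eq.symm ha)))⟩
  · rintro i a (rfl : a.down.1 = i) b (hb | hb)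
    · exact ⟨fun h => sub_one_ne (by norm_num) a.down.1 (by rw [← h] at hb; exact hb.symm), .inl hb⟩
    · exact ⟨fun h => add_one_ne (by norm_num) a.down.1 (by rw [← h] at hb; exact hb.symm),
        .inr (.inr hb)⟩
  · rintro i a (rfl : a.down.1 = i) b hb ⟨-, h | h | h⟩
    · exact hb (.inl (.inl h))
    · exact hb (.inl (.inr h))
    · exact hb (.inr h)

/-- The 5-cycle is self-complementary: multiplication by 2, with inverse multiplication by 3,
exchanges edges and non-edges. -/
theorem isHyperantihole_fiveCycleBlowup (hw : ∀ i, 0 < w i) :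
    IsHyperantihole 5 (fiveCycleBlowup.{u} w) := by
  have hσ : ∀ i : ZMod 5, 3 * (2 * i) = i ∧ 2 * (3 * i) = i := by decide
  have h2 : ∀ i x : ZMod 5, x ≠ 2 * (i - 1) → x ≠ 2 * i → x ≠ 2 * (i + 1) →
      x ≠ 2 * i ∧ (x = 2 * i - 1 ∨ x = 2 * i ∨ x = 2 * i + 1) := by decide
  have h3 : ∀ i x : ZMod 5, x = 2 * (i - 1) ∨ x = 2 * (i + 1) →
      ¬ (x = 2 * i - 1 ∨ x = 2 * i ∨ x = 2 * i + 1) := by decide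
  refine ⟨by norm_num, _, isCyclicPartition_fiveCycleBlowup hw
    ⟨fun i => 2 * i, fun i => 3 * i, fun i => (hσ i).1, fun i => (hσ i).2⟩, ?_, ?_, ?_⟩
  · intro i a ha b hb hab
    exact ⟨hab, .inr (.inl (Eq.trans hb (Eq.symm ha)))⟩
  · intro i a (ha : a.down.1 = 2 * i) b hb
    obtain ⟨h, h'⟩ := h2 i b.down.1 (fun h => hb (.inl (.inl h))) (fun h => hb (.inl (.inr h)))
      fun h => hb (.inr h)
    exact ⟨fun hab => h (hab ▸ ha), by rwa [ha]⟩
  · rintro i a (ha : a.down.1 = 2 * i) b hb ⟨-, h⟩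
    rw [ha] at h
    exact h3 i _ hb h

theorem fiveCycleBlowup_isIndContained {w' : ZMod 5 → ℕ} (h : ∀ i, w i ≤ w' i) :
    fiveCycleBlowup.{u} w ⊴ fiveCycleBlowup.{u} w' := by
  have hinj : Function.Injective fun a : ULift.{u} (Σ i, Fin (w i)) =>
      (⟨⟨a.down.1, Fin.castLE (h _) a.down.2⟩⟩ : ULift.{u} (Σ i, Fin (w' i))) := by
    rintro ⟨i, a⟩ ⟨j, b⟩ hab
    obtain ⟨hij, hab⟩ := Sigma.mk.inj_iff.1 (ULift.up.inj hab)
    obtain rfl : i = j := hij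
    have hab' : a = b := Fin.castLE_injective (h i) (eq_of_heq hab)
    rw [hab']
  exact ⟨⟨⟨_, hinj⟩, and_congr_left fun _ => hinj.ne_iff⟩⟩

theorem top_isIndContained_fiveCycleBlowup {V : Type u} [Finite V] :
    (⊤ : SimpleGraph V) ⊴ fiveCycleBlowup.{u} fun _ => Nat.card V + 1 := by
  have hinj : Function.Injective fun v : V =>
      (⟨⟨0, (Finite.equivFin V v).castSucc⟩⟩ :
        ULift.{u} (Σ _ : ZMod 5, Fin (Nat.card V + 1))) := by
    intro a b hab
    have := eq_of_heq (Sigma.mk.inj_iff.1 (ULift.up.inj hab)).2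
    exact (Finite.equivFin V).injective (Fin.castSucc_injective _ this)
  refine ⟨⟨⟨_, hinj⟩, ?_⟩⟩
  intro a b
  rw [top_adj]
  exact ⟨fun h hab => h.1 (hab ▸ rfl), fun h => ⟨hinj.ne h, .inr (.inl rfl)⟩⟩

theorem containsCompleteGraphs_hyperholeClassGE :
    ContainsCompleteGraphs (hyperholeClassGE.{u} 4) := fun _ hfin hne =>
  ⟨5, by norm_num, hfin, hne, _, _, inferInstance,
    isHyperhole_fiveCycleBlowup fun _ => Nat.succ_pos _, top_isIndContained_fiveCycleBlowup⟩

theorem containsCompleteGraphs_hyperantiholeClassGE :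
    ContainsCompleteGraphs (hyperantiholeClassGE.{u} 4) := fun _ hfin hne =>
  ⟨5, by norm_num, hfin, hne, _, _, inferInstance,
    isHyperantihole_fiveCycleBlowup fun _ => Nat.succ_pos _, top_isIndContained_fiveCycleBlowup⟩

theorem card_le_of_isClique_fiveCycleBlowup {n : ℕ} (hw : ∀ i, w i + w (i + 1) ≤ n)
    {s : Finset (ULift.{u} (Σ i, Fin (w i)))} (hs : (fiveCycleBlowup w).IsClique s) :
    s.card ≤ n := by
  have hdec : ∀ I : Finset (ZMod 5), (∀ x ∈ I, ∀ y ∈ I, y = x - 1 ∨ y = x ∨ y = x + 1) →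
      ∃ i, ∀ x ∈ I, x = i ∨ x = i + 1 := by decide
  obtain ⟨i, hi⟩ := hdec (s.image fun a => a.down.1) (by
    intro x hx y hy
    obtain ⟨a, ha, rfl⟩ := Finset.mem_image.1 hx
    obtain ⟨b, hb, rfl⟩ := Finset.mem_image.1 hy
    by_cases hab : a = b
    · exact .inr (.inl (by rw [hab]))
    · exact (hs ha hb hab).2)
  have hfib : ∀ j, (s.filter fun a => a.down.1 = j).card ≤ w j := by
    intro j
    rw [← Finset.card_range (w j)]
    refine Finset.card_le_card_of_injOn (fun a => (a.down.2 : ℕ)) ?_ ?_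
    · intro a ha
      obtain ⟨-, rfl⟩ := Finset.mem_filter.1 ha
      simp
    · rintro ⟨x, a⟩ ha ⟨y, b⟩ hb hab
      obtain ⟨-, rfl⟩ := Finset.mem_filter.1 ha
      obtain ⟨-, hb⟩ := Finset.mem_filter.1 hb
      obtain rfl : y = x := hb
      have hab' : a = b := Fin.ext hab
      rw [hab']
  have hsub : s ⊆ (s.filter fun a => a.down.1 = i) ∪ s.filter fun a => a.down.1 = i + 1 := by
    intro a ha
    have := hi _ (Finset.mem_image_of_mem _ ha)
    simpa [ha] using this
  exact (Finset.card_le_card hsub).trans ((Finset.card_union_le _ _).trans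
    ((add_le_add (hfib _) (hfib _)).trans (hw i)))

/-- Stable sets of the 5-cycle have at most two vertices, hence so do the colour classes of a
blowup. -/
theorem sum_le_of_colorable_fiveCycleBlowup {m : ℕ} (h : (fiveCycleBlowup.{u} w).Colorable m) :
    ∑ i, w i ≤ 2 * m := by
  classical
  obtain ⟨C⟩ := h
  have hdec : ∀ I : Finset (ZMod 5), (∀ x ∈ I, ∀ y ∈ I, x ≠ y → ¬ (y = x - 1 ∨ y = x ∨ y = x + 1)) →
      I.card ≤ 2 := by decide
  have hcard : Fintype.card (ULift.{u} (Σ i, Fin (w i))) = ∑ i, w i := by simp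
  rw [← hcard, ← Fintype.card_fin m, ← Finset.card_univ, ← Finset.card_univ]
  refine Finset.card_le_mul_card_image_of_maps_to (f := C) (fun _ _ => Finset.mem_univ _) 2 ?_
  intro c _
  have hne : ∀ a b, C a = c → C b = c → a ≠ b →
      ¬ (b.down.1 = a.down.1 - 1 ∨ b.down.1 = a.down.1 ∨ b.down.1 = a.down.1 + 1) :=
    fun a b ha hb hab h => C.valid (show (fiveCycleBlowup w).Adj a b from ⟨hab, h⟩)
      (ha.trans hb.symm)
  rw [← Finset.card_image_of_injOn (f := fun a => a.down.1)]
  · refine hdec _ ?_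
    intro x hx y hy hxy
    obtain ⟨a, ha, rfl⟩ := Finset.mem_image.1 hx
    obtain ⟨b, hb, rfl⟩ := Finset.mem_image.1 hy
    exact hne a b (Finset.mem_filter.1 ha).2 (Finset.mem_filter.1 hb).2 fun h => hxy (h ▸ rfl)
  · intro a ha b hb hab
    by_contra h
    exact hne a b (Finset.mem_filter.1 ha).2 (Finset.mem_filter.1 hb).2 h (.inr (.inl hab.symm))

/-- A blowup of the `5`-cycle with clique number `n` and chromatic number `fT n`. -/
theorem exists_fiveCycleBlowup_extremal (n : ℕ) (hn : 1 ≤ n) : ∃ w : ZMod 5 → ℕ,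
    Nonempty (ULift.{u} (Σ i, Fin (w i))) ∧
    ((fiveCycleBlowup.{u} w).chromaticNumber ≤ fT (fiveCycleBlowup.{u} w).cliqueNum →
      (fiveCycleBlowup.{u} w).cliqueNum = n ∧ (fiveCycleBlowup.{u} w).chromaticNumber = fT n) := by
  let p := (n + 1) / 2
  let q := n / 2
  -- Consecutive weights sum to at most $p+q=n$, while the total $2n+q$ forces $n+\lceil
  -- q/2\rceil=f_T(n)$ colours. For $n=1$ some parts are empty.
  let w : ZMod 5 → ℕ := fun i => ![p, q, p, q, q] i
  have hpq : p + q = n := by simp only [p, q]; omega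
  have hqp : q ≤ p := by simp only [p, q]; omega
  have hsum : ∑ i, w i = p + q + p + q + q := Fin.sum_univ_five _
  have hw : ∀ i, w i + w (i + 1) ≤ n := by
    intro i
    have : w i + w (i + 1) = p + q ∨ w i + w (i + 1) = q + p ∨ w i + w (i + 1) = q + q := by
      fin_cases i
      · exact .inl rfl
      · exact .inr (.inl rfl)
      · exact .inl rfl
      · exact .inr (.inr rfl)
      · exact .inr (.inl rfl)
    omega
  refine ⟨w, ⟨⟨⟨(0 : ZMod 5), ⟨0, ?_⟩⟩⟩⟩, fun hle => ?_⟩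
  · change 0 < p
    omega
  · have hclq : (fiveCycleBlowup.{u} w).cliqueNum ≤ n := by
      obtain ⟨s, hs⟩ := (fiveCycleBlowup.{u} w).exists_isNClique_cliqueNum
      rw [← hs.card_eq]
      exact card_le_of_isClique_fiveCycleBlowup hw hs.isClique
    have hge : (fT n : ℕ∞) ≤ (fiveCycleBlowup.{u} w).chromaticNumber := by
      rw [le_chromaticNumber_iff_colorable]
      intro m hm
      have := sum_le_of_colorable_fiveCycleBlowup hm
      rw [hsum] at this
      have h : fT n ≤ m := by
        rw [fT_eq]
        simp only [p, q] at this
        omega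
      exact_mod_cast h
    -- No clique of size $n$ is exhibited: $f_T(n)\le\chi\le f_T(\omega)$ and strict monotonicity
    -- give $n\le\omega$.
    have heq : (fiveCycleBlowup.{u} w).cliqueNum = n := by
      refine le_antisymm hclq (fT_strictMono.le_iff_le.1 ?_)
      exact_mod_cast hge.trans hle
    exact ⟨heq, le_antisymm (heq ▸ hle) hge⟩

end Blowup

/-! ### Optimality for the three classes. -/

theorem isOptimalChiBounding_hyperholeClassGE :
    IsOptimalChiBounding (hyperholeClassGE.{u} 4) fT := by
  have hb : IsChiBounding (hyperholeClassGE.{u} 4) fT := fun V G h =>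
    isChiBounding_ringClassGE V G (ringClassGE_of_hyperholeClassGE h)
  refine ⟨⟨isHereditary_hyperholeClassGE 4, fT, hb⟩, containsCompleteGraphs_hyperholeClassGE, hb,
    fun n hn => ?_⟩
  obtain ⟨w, hne, h⟩ := exists_fiveCycleBlowup_extremal.{u} n hn
  -- Weights may vanish, so the graph is placed inside the blowup with all weights raised by 1.
  have hmem : hyperholeClassGE.{u} 4 _ (fiveCycleBlowup.{u} w) :=
    ⟨5, by norm_num, inferInstance, hne, _, _, inferInstance,
      isHyperhole_fiveCycleBlowup fun i => Nat.succ_pos (w i),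
      fiveCycleBlowup_isIndContained fun i => Nat.le_succ (w i)⟩
  exact ⟨_, _, hmem, h (hb _ _ hmem)⟩

theorem isOptimalChiBounding_hyperantiholeClassGE :
    IsOptimalChiBounding (hyperantiholeClassGE.{u} 4) fT := by
  have hb := isChiBounding_hyperantiholeClassGE.{u}
  refine ⟨⟨isHereditary_hyperantiholeClassGE 4, fT, hb⟩,
    containsCompleteGraphs_hyperantiholeClassGE, hb, fun n hn => ?_⟩
  obtain ⟨w, hne, h⟩ := exists_fiveCycleBlowup_extremal.{u} n hn
  have hmem : hyperantiholeClassGE.{u} 4 _ (fiveCycleBlowup.{u} w) :=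
    ⟨5, by norm_num, inferInstance, hne, _, _, inferInstance,
      isHyperantihole_fiveCycleBlowup fun i => Nat.succ_pos (w i),
      fiveCycleBlowup_isIndContained fun i => Nat.le_succ (w i)⟩
  exact ⟨_, _, hmem, h (hb _ _ hmem)⟩

theorem isOptimalChiBounding_ringClassGE : IsOptimalChiBounding (ringClassGE.{u} 4) fT := by
  have hb := isChiBounding_ringClassGE.{u}
  obtain ⟨-, hcomplete, -, hopt⟩ := isOptimalChiBounding_hyperholeClassGE.{u}
  refine ⟨⟨isHereditary_ringClassGE 4, fT, hb⟩,
    fun V hfin hne => ringClassGE_of_hyperholeClassGE (hcomplete V hfin hne), hb, fun n hn => ?_⟩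
  obtain ⟨V, G, hG, h⟩ := hopt n hn
  exact ⟨V, G, ringClassGE_of_hyperholeClassGE hG, h⟩

end RingColoring

theorem theorem6p12 :
    (RingColoring.IsChiBounded (RingColoring.hyperholeClassGE.{u} 4) ∧
      RingColoring.IsChiBounded (RingColoring.hyperantiholeClassGE.{u} 4) ∧
      RingColoring.IsChiBounded (RingColoring.ringClassGE.{u} 4)) ∧
    (RingColoring.IsOptimalChiBounding (RingColoring.hyperholeClassGE.{u} 4) RingColoring.fT ∧
      RingColoring.IsOptimalChiBounding (RingColoring.hyperantiholeClassGE.{u} 4)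
        RingColoring.fT ∧
      RingColoring.IsOptimalChiBounding (RingColoring.ringClassGE.{u} 4) RingColoring.fT) :=
  ⟨⟨RingColoring.isOptimalChiBounding_hyperholeClassGE.1,
    RingColoring.isOptimalChiBounding_hyperantiholeClassGE.1,
    RingColoring.isOptimalChiBounding_ringClassGE.1⟩,
    RingColoring.isOptimalChiBounding_hyperholeClassGE,
    RingColoring.isOptimalChiBounding_hyperantiholeClassGE,
    RingColoring.isOptimalChiBounding_ringClassGE⟩
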